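/- Let $n\ge 3$, let $\Omega\subset\mathbb R^n$ be a bounded open set, and let $a:\mathbb R\to\mathbb R$ be continuous with $0<m\le a(\xi)\le M$ for all $\xi\in\mathbb R$. Let $g\in L^2(\Omega)$ and $r\ge 0$, and put $$ l_r(v)(x)=\int_{\Omega\cap B(x,r)} g(y)\,v(y)\,dy , $$ where $B(x,r)$ is the closed ball with centre $x$ and radius $r$. Let $p,q>1$ with $\frac1p+\frac1q=1$ and $p<\frac{n}{n-2}$, let $f\in L^\infty(0,\infty;L^q(\Omega))$, and let $0<T\le\infty$. Let $u$ be a classical solution on $[0,T)$ of $$ u_t-\operatorname{div}\bigl(a(l_r(u(t)))\nabla u\bigr)=f \ \text{ in }(0,T)\times\Omega,\qquad u=0\ \text{ on }(0,T)\times\partial\Omega,\qquad u(0,\cdot)=u_0\ \text{ in }\Omega , $$ that is: $u$ is continuous on $[0,T)\times\overline\Omega$; the derivatives $u_t$ and $\nabla u$ exist and are continuous in $(0,T)\times\Omega$; for each $t\in(0,T)$ the field $x\mapsto a(l_r(u(t))(x))\nabla u(t,x)$ is differentiable in $\Omega$; and the three equations hold at every point. For $1\le s\le\infty$ let $U_s=\sup_{0\le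 t<T}\|u(t,\cdot)\|_{L^s(\Omega)}$. If $U_q<\infty$, then $U_\infty<\infty$. -/

import Mathlib

open MeasureTheory Set
open scoped ENNReal

noncomputable section

namespace NonlocalDiffusion

/-- The interval `[0, T)`, where `0 < T ≤ ∞`. -/
def timeIco (T : EReal) : Set ℝ := {t | 0 ≤ t ∧ (t : EReal) < T}

/-- The interval `(0, T)`, where `0 < T ≤ ∞`. -/
def timeIoo (T : EReal) : Set ℝ := {t | 0 < t ∧ (t : EReal) < T}

/-- The nonlocal functional `l_r(v)(x) = ∫_{Ω ∩ B(x, r)} g(y) v(y) dy`, with `B(x, r)` the closed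
ball. -/
def nonlocal {n : ℕ} (Ω : Set (EuclideanSpace ℝ (Fin n))) (g : EuclideanSpace ℝ (Fin n) → ℝ)
    (r : ℝ) (v : EuclideanSpace ℝ (Fin n) → ℝ) (x : EuclideanSpace ℝ (Fin n)) : ℝ :=
  ∫ y in Ω ∩ Metric.closedBall x r, g y * v y

/-- The flux `a(l_r(v)) ∇v`. -/
def flux {n : ℕ} (Ω : Set (EuclideanSpace ℝ (Fin n))) (a : ℝ → ℝ)
    (g : EuclideanSpace ℝ (Fin n) → ℝ) (r : ℝ) (v : EuclideanSpace ℝ (Fin n) → ℝ)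
    (x : EuclideanSpace ℝ (Fin n)) : EuclideanSpace ℝ (Fin n) :=
  a (nonlocal Ω g r v x) • gradient v x

/-- The divergence `∑ i, ∂ᵢ Fᵢ` of a vector field. -/
def divergence {n : ℕ} (F : EuclideanSpace ℝ (Fin n) → EuclideanSpace ℝ (Fin n))
    (x : EuclideanSpace ℝ (Fin n)) : ℝ :=
  ∑ i : Fin n, (fderiv ℝ F x (EuclideanSpace.single i 1)) i

/-- `u` is a classical solution on `[0, T)` of the problem
`u_t - div(a(l_r(u(t))) ∇u) = f` in `(0, T) × Ω`, `u = 0` on `(0, T) × ∂Ω`, `u(0) = u₀` in `Ω`: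
it is continuous on `[0, T) × closure Ω`, of class `C¹` in `(0, T) × Ω`, its flux is differentiable
with respect to `x`, and the equations hold at every point. (As `a` is only continuous, the
differentiability of the flux is what gives a classical meaning to the second-order term.) -/
structure IsClassicalSolution {n : ℕ} (Ω : Set (EuclideanSpace ℝ (Fin n))) (T : EReal)
    (a : ℝ → ℝ) (g : EuclideanSpace ℝ (Fin n) → ℝ) (r : ℝ)
    (f : ℝ → EuclideanSpace ℝ (Fin n) → ℝ) (u₀ : EuclideanSpace ℝ (Fin n) → ℝ)
    (u : ℝ → EuclideanSpace ℝ (Fin n) → ℝ) : Prop where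
  continuousOn : ContinuousOn (fun z : ℝ × EuclideanSpace ℝ (Fin n) => u z.1 z.2)
    (timeIco T ×ˢ closure Ω)
  differentiableAt_time : ∀ t ∈ timeIoo T, ∀ x ∈ Ω, DifferentiableAt ℝ (fun s => u s x) t
  continuousOn_deriv_time :
    ContinuousOn (fun z : ℝ × EuclideanSpace ℝ (Fin n) => deriv (fun s => u s z.2) z.1)
      (timeIoo T ×ˢ Ω)
  differentiableAt_space : ∀ t ∈ timeIoo T, ∀ x ∈ Ω, DifferentiableAt ℝ (u t) x
  continuousOn_gradient :
    ContinuousOn (fun z : ℝ × EuclideanSpace ℝ (Fin n) => gradient (u z.1) z.2)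
      (timeIoo T ×ˢ Ω)
  differentiableAt_flux : ∀ t ∈ timeIoo T, ∀ x ∈ Ω,
    DifferentiableAt ℝ (flux Ω a g r (u t)) x
  equation : ∀ t ∈ timeIoo T, ∀ x ∈ Ω,
    deriv (fun s => u s x) t - divergence (flux Ω a g r (u t)) x = f t x
  boundary : ∀ t ∈ timeIoo T, ∀ x ∈ frontier Ω, u t x = 0
  initial : ∀ x ∈ Ω, u 0 x = u₀ x

/-- `f ∈ L^∞(0, ∞; L^q(Ω))`: for almost every `t > 0` the function `f t` represents the value at
`t` of an essentially bounded, strongly measurable map from `(0, ∞)` to `L^q(Ω)`. -/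
def MemLinftyLq {n : ℕ} (Ω : Set (EuclideanSpace ℝ (Fin n))) (q : ℝ) (hq : 1 < q)
    (f : ℝ → EuclideanSpace ℝ (Fin n) → ℝ) : Prop :=
  haveI : Fact (1 ≤ ENNReal.ofReal q) := ⟨ENNReal.one_le_ofReal.2 hq.le⟩
  ∃ F : ℝ → Lp ℝ (ENNReal.ofReal q) (volume.restrict Ω),
    MemLp F ∞ (volume.restrict (Ioi (0 : ℝ))) ∧
      ∀ᵐ t ∂(volume.restrict (Ioi (0 : ℝ))), F t =ᵐ[volume.restrict Ω] f t

/-- `U_s = sup_{0 ≤ t < T} |u(t)|_{L^s(Ω)}`, with values in `[0, ∞]`, for `1 ≤ s ≤ ∞`. -/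
def supLpNorm {n : ℕ} (Ω : Set (EuclideanSpace ℝ (Fin n))) (T : EReal) (s : ℝ≥0∞)
    (u : ℝ → EuclideanSpace ℝ (Fin n) → ℝ) : ℝ≥0∞ :=
  ⨆ t ∈ timeIco T, eLpNorm (u t) s (volume.restrict Ω)

end NonlocalDiffusion

end

namespace NonlocalDiffusion

/-! At each time the nonlocal coefficient is regarded as a given function `A ≥ m`, so the bound is a
maximum estimate for a linear equation, obtained by Stampacchia's level-set method. For `k > 0` put
`z = (v - k)₊`. Testing the equation with `z³` gives `d/dt ∫ z⁴ ≤ -3m ∫ |∇(z²)|² + 4 ∫ z³ f`. If all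
level sets `{v(t) > k}` have measure at most `μ`, Sobolev applied to `z²`, Hölder and Young turn
this into `y' ≤ l (C μ^(1+δ) - y)` for `y = ∫ z⁴`, with `δ = 4 (1/p - (n-2)/n)`. Positivity of `δ`
is exactly the condition `p < n/(n-2)`.

When `k` bounds the initial values, `y(0) = 0`, so Gronwall gives `y ≤ C μ^(1+δ)` uniformly in time.
Chebyshev then bounds `|{v(t) > h}|` by `C μ^(1+δ) / (h-k)⁴`, and
`exists_forall_pos_of_superlinear_decay` yields a level never exceeded on a set of positive measure.
Applying this to `u` and `-u` finishes the proof.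

Fourth powers keep everything classical: `z²` is `C¹` although `z` need not be, and `z` has compact
support in `Ω` because `k > 0`, so no regularity of the boundary is required. -/

/-! ### Calculus tools: divergence theorem, level-set iteration, Gronwall, truncated powers. -/

theorem integral_divergence_eq_zero {n : ℕ} (hn : 0 < n)
    {V : EuclideanSpace ℝ (Fin n) → EuclideanSpace ℝ (Fin n)}
    (hV : Differentiable ℝ V) (hc : HasCompactSupport V) (hi : Integrable (divergence V)) :
    ∫ x, divergence V x = 0 := by
  obtain ⟨k, rfl⟩ := Nat.exists_eq_succ_of_ne_zero hn.ne'
  obtain ⟨R, hR0, hR⟩ := hc.isCompact.isBounded.subset_ball_lt 0 0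
  have hmp := PiLp.volume_preserving_toLp (Fin (k + 1))
  have hemb : MeasurableEmbedding (WithLp.toLp 2 : (Fin (k + 1) → ℝ) → _) :=
    (MeasurableEquiv.toLp 2 (Fin (k + 1) → ℝ)).measurableEmbedding
  have hzero : ∀ x : EuclideanSpace ℝ (Fin (k + 1)), ∀ i, R ≤ |x i| → V x = 0 := by
    intro x i hx
    by_contra h
    have h1 := hR (subset_tsupport V h)
    rw [mem_ball_zero_iff] at h1
    have h2 := PiLp.norm_apply_le x i
    rw [Real.norm_eq_abs] at h2
    linarith
  have hdzero : ∀ y : Fin (k + 1) → ℝ, y ∉ Icc (fun _ => -R) (fun _ => R) →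
      divergence V (WithLp.toLp 2 y) = 0 := by
    intro y hy
    have hx : WithLp.toLp 2 y ∉ tsupport V := by
      intro h
      apply hy
      have h1 := hR h
      rw [mem_ball_zero_iff] at h1
      have h2 : ∀ i, |y i| ≤ R := fun i => by
        have := PiLp.norm_apply_le (WithLp.toLp 2 y) i
        rw [Real.norm_eq_abs] at this
        exact this.trans h1.le
      exact ⟨fun i => (abs_le.1 (h2 i)).1, fun i => (abs_le.1 (h2 i)).2⟩
    have : fderiv ℝ V (WithLp.toLp 2 y) = 0 := by
      by_contra h
      exact hx (support_fderiv_subset ℝ h)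
    simp [divergence, this]
  rw [← hmp.integral_comp hemb, ← setIntegral_eq_integral_of_forall_compl_eq_zero hdzero]
  let e := (PiLp.continuousLinearEquiv 2 ℝ (fun _ : Fin (k + 1) => ℝ)).symm
  -- This form of the divergence theorem on a box needs only differentiability and an integrable
  -- divergence. That matters because the flux is not assumed to be `C¹`.
  have key := integral_divergence_of_hasFDerivAt_off_countable' (E := ℝ) (fun _ : Fin (k + 1) => -R)
    (fun _ => R) (fun _ => by linarith) (fun i y => V (WithLp.toLp 2 y) i)
    (fun i y => (EuclideanSpace.proj i : EuclideanSpace ℝ (Fin (k + 1)) →L[ℝ] ℝ) ∘L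
      (fderiv ℝ V (WithLp.toLp 2 y)) ∘L (e : (Fin (k + 1) → ℝ) →L[ℝ] _)) ∅ countable_empty
    (fun i => by
      have h1 : Continuous fun y : Fin (k + 1) → ℝ => V (WithLp.toLp 2 y) :=
        hV.continuous.comp (PiLp.continuous_toLp 2 _)
      exact ((EuclideanSpace.proj (𝕜 := ℝ) i).continuous.comp h1).continuousOn)
    (fun y _ i => by
      exact (EuclideanSpace.proj (𝕜 := ℝ) i).hasFDerivAt.comp y
        ((hV (WithLp.toLp 2 y)).hasFDerivAt.comp y e.hasFDerivAt))
    (by exact ((hmp.integrable_comp_emb hemb).2 hi).integrableOn)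
  refine Eq.trans ?_ (key.trans ?_)
  · rfl
  · refine Finset.sum_eq_zero fun i _ => ?_
    have h1 : ∀ (s : ℝ) (x : Fin k → ℝ), R ≤ |s| →
        V (WithLp.toLp 2 (i.insertNth s x)) = 0 := fun s x hs => by
      apply hzero _ i
      simpa using hs
    have e1 : ∀ x, V (WithLp.toLp 2 (i.insertNth R x)) = 0 := fun x => h1 R x (le_abs_self _)
    have e2 : ∀ x, V (WithLp.toLp 2 (i.insertNth (-R) x)) = 0 :=
      fun x => h1 (-R) x (by rw [abs_neg]; exact le_abs_self _)
    simp [e1, e2]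

/-- Stampacchia's lemma: a level-set estimate with a superlinear power of the measure of the
previous level set forces the level sets to become negligible at a finite level. -/
theorem exists_forall_pos_of_superlinear_decay {P : ℝ → ℝ → Prop}
    (hmono : ∀ k h μ, k ≤ h → P k μ → P h μ) {k₀ μ₀ C δ : ℝ} (hμ₀ : 0 < μ₀) (hC : 0 < C)
    (hδ : 0 < δ) (h₀ : P k₀ μ₀)
    (hmono' : ∀ k μ ν, μ ≤ ν → P k μ → P k ν)
    (hstep : ∀ k h μ, k₀ ≤ k → k < h → 0 < μ → P k μ → P h (C * μ ^ (1 + δ) / (h - k) ^ 4)) :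
    ∃ K, ∀ ε > 0, P K ε := by
  -- The levels are `k₀ + D (1 - 2⁻ʲ)`, with measure bounds `μ₀ ρʲ`. The factor `16ʲ` coming from
  -- the fourth power of the gaps is cancelled by `ρ ^ δ = 1 / 16`.
  set ρ : ℝ := (1 / 16) ^ (1 / δ) with hρ
  have hρ0 : 0 < ρ := by positivity
  have hρ1 : ρ < 1 := Real.rpow_lt_one (by norm_num) (by norm_num) (by positivity)
  have hρδ : ρ ^ δ = 1 / 16 := by
    rw [hρ, ← Real.rpow_mul (by norm_num), one_div_mul_cancel hδ.ne', Real.rpow_one]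
  -- The induction closes when `16 C μ₀^δ ≤ D⁴ ρ`; the summand `1` gives `D ≤ D⁴`.
  set D : ℝ := 16 * C * μ₀ ^ δ / ρ + 1 with hD
  have hD1 : 1 ≤ D := by
    have : 0 ≤ 16 * C * μ₀ ^ δ / ρ := by positivity
    linarith
  have hDle : 16 * C * μ₀ ^ δ ≤ D ^ 4 * ρ := by
    have h1 : 16 * C * μ₀ ^ δ = (D - 1) * ρ := by rw [hD]; field_simp; ring
    have h2 : D ≤ D ^ 4 := le_self_pow₀ hD1 (by norm_num)
    rw [h1]
    gcongr
    linarith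
  have hk : ∀ j : ℕ, P (k₀ + D * (1 - (1 / 2) ^ j)) (μ₀ * ρ ^ j) := by
    intro j
    induction j with
    | zero => simpa using h₀
    | succ j ih =>
      have hp : (0 : ℝ) < (1 / 2) ^ j := by positivity
      have hp1 : ((1 : ℝ) / 2) ^ j ≤ 1 := pow_le_one₀ (by norm_num) (by norm_num)
      refine hmono' _ _ _ ?_ (hstep _ _ _ ?_ ?_ (by positivity) ih)
      · have e1 : k₀ + D * (1 - (1 / 2) ^ (j + 1)) - (k₀ + D * (1 - (1 / 2) ^ j))
            = D * (1 / 2) ^ j / 2 := by ring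
        have e2 : (μ₀ * ρ ^ j) ^ (1 + δ) = μ₀ * μ₀ ^ δ * (ρ ^ j * (1 / 16) ^ j) := by
          have : (ρ ^ j) ^ δ = (1 / 16) ^ j := by
            rw [← hρδ, ← Real.rpow_natCast, ← Real.rpow_natCast, ← Real.rpow_mul hρ0.le,
              ← Real.rpow_mul hρ0.le, mul_comm]
          rw [Real.rpow_add (by positivity), Real.rpow_one,
            Real.mul_rpow hμ₀.le (by positivity), this]
          ring
        have e3 : ((1 : ℝ) / 2) ^ j * (1 / 2) ^ j * ((1 / 2) ^ j * (1 / 2) ^ j) = (1 / 16) ^ j := by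
          rw [← mul_pow, ← mul_pow]; norm_num
        rw [e1, e2, div_le_iff₀ (by positivity)]
        have e4 : (D * (1 / 2) ^ j / 2) ^ 4 = D ^ 4 * (1 / 16) ^ j / 16 := by
          rw [← e3]; ring
        rw [e4]
        have h5 : 0 ≤ μ₀ * ρ ^ j * (1 / 16) ^ j / 16 := by positivity
        have := mul_le_mul_of_nonneg_left hDle h5
        calc _ = μ₀ * ρ ^ j * (1 / 16) ^ j / 16 * (16 * C * μ₀ ^ δ) := by ring
          _ ≤ _ := this
          _ = _ := by ring
      · have : 0 ≤ D * (1 - (1 / 2) ^ j) := mul_nonneg (by linarith) (by linarith)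
        linarith
      · have : (0 : ℝ) < D * (1 / 2) ^ j := by positivity
        rw [pow_succ]
        linarith
  refine ⟨k₀ + D, fun ε hε => ?_⟩
  obtain ⟨j, hj⟩ := exists_pow_lt_of_lt_one (div_pos hε hμ₀) hρ1
  refine hmono' _ _ _ ?_ (hmono _ _ _ ?_ (hk j))
  · rw [lt_div_iff₀ hμ₀] at hj
    linarith
  · have : 0 ≤ D * (1 / 2) ^ j := by positivity
    linarith

/-- A Gronwall bound on `[0, b]` with zero initial value. -/
theorem le_of_hasDerivAt_le_mul_sub {y y' : ℝ → ℝ} {b B l : ℝ} (hb : 0 ≤ b) (hB : 0 ≤ B)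
    (hc : ContinuousOn y (Icc 0 b)) (h0 : y 0 ≤ 0)
    (hd : ∀ t ∈ Ioo 0 b, HasDerivAt y (y' t) t)
    (hle : ∀ t ∈ Ioo 0 b, y' t ≤ l * (B - y t)) : y b ≤ B := by
  have hanti : AntitoneOn (fun t => (y t - B) * Real.exp (l * t)) (Icc 0 b) := by
    have hD : ∀ t ∈ Ioo 0 b, HasDerivAt (fun t => (y t - B) * Real.exp (l * t))
        (y' t * Real.exp (l * t) + (y t - B) * (Real.exp (l * t) * l)) t := fun t ht => by
      have h2 : HasDerivAt (fun t => l * t) l t := by simpa using (hasDerivAt_id t).const_mul l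
      exact ((hd t ht).sub_const B).mul h2.exp
    refine antitoneOn_of_deriv_nonpos (convex_Icc 0 b)
      ((hc.sub continuousOn_const).mul (by fun_prop)) ?_ ?_
    · rw [interior_Icc]
      exact fun t ht => (hD t ht).differentiableAt.differentiableWithinAt
    · rw [interior_Icc]
      intro t ht
      rw [(hD t ht).deriv]
      have := hle t ht
      have h3 := Real.exp_pos (l * t)
      nlinarith
  have h := hanti (left_mem_Icc.2 hb) (right_mem_Icc.2 hb) hb
  simp only [mul_zero, Real.exp_zero, mul_one] at h
  by_contra hcon
  have : 0 < (y b - B) * Real.exp (l * b) := mul_pos (by linarith) (Real.exp_pos _)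
  linarith

/-- An exponent of at least two removes the corner of the truncation: at `s = k` the function is
`O(|t - s| ^ (j + 2))`, so its derivative vanishes there. -/
theorem hasDerivAt_max_sub_zero_pow (k s : ℝ) (j : ℕ) :
    HasDerivAt (fun s : ℝ => max (s - k) 0 ^ (j + 2))
      (((j + 2 : ℕ) : ℝ) * max (s - k) 0 ^ (j + 1)) s := by
  rcases lt_trichotomy s k with h | h | h
  · have he : (fun s : ℝ => max (s - k) 0 ^ (j + 2)) =ᶠ[nhds s] fun _ => 0 := by
      filter_upwards [Iio_mem_nhds h] with x hx
      rw [max_eq_right (by linarith [mem_Iio.1 hx])]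
      simp
    rw [max_eq_right (by linarith)]
    simpa using (hasDerivAt_const s (0 : ℝ)).congr_of_eventuallyEq he
  · subst h
    have hO : (fun t : ℝ => max (t - s) 0 ^ (j + 2)) =O[nhds s] fun t => ‖t - s‖ ^ (j + 2) := by
      refine Asymptotics.IsBigO.of_bound 1 (Filter.Eventually.of_forall fun t => ?_)
      rw [one_mul, norm_pow, norm_pow, norm_norm]
      gcongr
      rw [Real.norm_eq_abs, Real.norm_eq_abs, abs_of_nonneg (le_max_right _ _)]
      exact max_le (le_abs_self _) (abs_nonneg _)
    have := (hO.hasFDerivAt (𝕜 := ℝ) (by omega)).hasDerivAt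
    simpa using this
  · have he : (fun s : ℝ => max (s - k) 0 ^ (j + 2)) =ᶠ[nhds s] fun s => (s - k) ^ (j + 2) := by
      filter_upwards [Ioi_mem_nhds h] with x hx
      rw [max_eq_left (by linarith [mem_Ioi.1 hx])]
    rw [max_eq_left (by linarith)]
    have := ((hasDerivAt_id s).sub_const k).fun_pow (j + 2)
    simpa using this.congr_of_eventuallyEq he

/-! ### Truncations at a positive level and the energy identity. -/

section Excess

variable {n : ℕ}

/-- The truncation `(v - k)₊` on `Ω`, extended by zero. -/
noncomputable def excess (Ω : Set (EuclideanSpace ℝ (Fin n))) (k : ℝ) (v : EuclideanSpace ℝ (Fin n) → ℝ) :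
    EuclideanSpace ℝ (Fin n) → ℝ :=
  Ω.indicator fun x => max (v x - k) 0

variable {Ω : Set (EuclideanSpace ℝ (Fin n))} {k : ℝ} {v : EuclideanSpace ℝ (Fin n) → ℝ}

theorem excess_nonneg (x : EuclideanSpace ℝ (Fin n)) : 0 ≤ excess Ω k v x :=
  indicator_nonneg (fun _ _ => le_max_right _ _) x

theorem excess_of_mem {x : EuclideanSpace ℝ (Fin n)} (hx : x ∈ Ω) :
    excess Ω k v x = max (v x - k) 0 := indicator_of_mem hx _

theorem excess_of_notMem {x : EuclideanSpace ℝ (Fin n)} (hx : x ∉ Ω) :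
    excess Ω k v x = 0 := indicator_of_notMem hx _

theorem isCompact_superlevel (hΩb : Bornology.IsBounded Ω) (hv : ContinuousOn v (closure Ω)) :
    IsCompact {x | x ∈ closure Ω ∧ k ≤ v x} := by
  have : IsCompact (closure Ω) := hΩb.isCompact_closure
  exact this.of_isClosed_subset (hv.preimage_isClosed_of_isClosed isClosed_closure isClosed_Ici)
    (fun x hx => hx.1)

/-- A positive level is not attained on the boundary. With compactness this makes every excess
compactly supported inside `Ω`, so extension by zero is harmless. -/
theorem superlevel_subset (hΩ : IsOpen Ω) (hb : ∀ x ∈ frontier Ω, v x = 0) (hk : 0 < k) :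
    {x | x ∈ closure Ω ∧ k ≤ v x} ⊆ Ω := by
  intro x hx
  by_contra h
  have : x ∈ frontier Ω := by
    rw [frontier, hΩ.interior_eq]
    exact ⟨hx.1, h⟩
  have h1 := hb x this
  have h2 := hx.2
  linarith

theorem excess_eq_zero_of_notMem_superlevel {x : EuclideanSpace ℝ (Fin n)}
    (hx : x ∉ {x | x ∈ closure Ω ∧ k ≤ v x}) : excess Ω k v x = 0 := by
  by_cases h : x ∈ Ω
  · rw [excess_of_mem h, max_eq_right]
    by_contra hc
    exact hx ⟨subset_closure h, by linarith⟩
  · exact excess_of_notMem h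

theorem continuous_of_continuousOn_of_eq_zero {X G : Type*} [TopologicalSpace X]
    [TopologicalSpace G] [Zero G] {F : X → G} {s K : Set X} (hs : IsOpen s) (hK : IsClosed K)
    (hKs : K ⊆ s) (hF : ContinuousOn F s) (h0 : ∀ x ∉ K, F x = 0) : Continuous F := by
  rw [continuous_iff_continuousAt]
  intro x
  by_cases hx : x ∈ s
  · exact hF.continuousAt (hs.mem_nhds hx)
  · have : F =ᶠ[nhds x] fun _ => 0 := by
      filter_upwards [hK.isOpen_compl.mem_nhds (fun h => hx (hKs h))] with y hy using h0 y hy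
    exact continuousAt_const.congr this.symm

/-- The factor `h` may blow up at the boundary; a positive power of the excess vanishes before it is
reached. -/
theorem continuous_excess_pow_smul {G : Type*} [NormedAddCommGroup G] [NormedSpace ℝ G]
    (hΩ : IsOpen Ω) (hΩb : Bornology.IsBounded Ω)
    (hv : ContinuousOn v (closure Ω)) (hb : ∀ x ∈ frontier Ω, v x = 0) (hk : 0 < k)
    {h : EuclideanSpace ℝ (Fin n) → G} (hh : ContinuousOn h Ω) (j : ℕ) :
    Continuous (fun x => excess Ω k v x ^ (j + 1) • h x) ∧
      HasCompactSupport (fun x => excess Ω k v x ^ (j + 1) • h x) := by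
  have hK := isCompact_superlevel (k := k) hΩb hv
  have h0 : ∀ x ∉ {x | x ∈ closure Ω ∧ k ≤ v x}, excess Ω k v x ^ (j + 1) • h x = 0 :=
    fun x hx => by simp [excess_eq_zero_of_notMem_superlevel hx]
  refine ⟨continuous_of_continuousOn_of_eq_zero hΩ hK.isClosed (superlevel_subset hΩ hb hk) ?_ h0,
    HasCompactSupport.intro hK h0⟩
  have h1 : ContinuousOn (fun x => max (v x - k) 0 ^ (j + 1) • h x) Ω :=
    (((hv.mono subset_closure).sub continuousOn_const).sup continuousOn_const |>.pow _).smul hh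
  exact h1.congr fun x hx => by simp [excess_of_mem hx]

theorem continuous_excess (hΩ : IsOpen Ω) (hΩb : Bornology.IsBounded Ω)
    (hv : ContinuousOn v (closure Ω)) (hb : ∀ x ∈ frontier Ω, v x = 0) (hk : 0 < k) :
    Continuous (excess Ω k v) ∧ HasCompactSupport (excess Ω k v) := by
  simpa using continuous_excess_pow_smul hΩ hΩb hv hb hk (h := fun _ => (1 : ℝ))
    continuousOn_const 0

theorem hasFDerivAt_excess_pow (hΩ : IsOpen Ω) (hΩb : Bornology.IsBounded Ω)
    (hv : ContinuousOn v (closure Ω)) (hb : ∀ x ∈ frontier Ω, v x = 0) (hk : 0 < k)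
    (hd : ∀ x ∈ Ω, DifferentiableAt ℝ v x) (j : ℕ) (x : EuclideanSpace ℝ (Fin n)) :
    HasFDerivAt (fun x => excess Ω k v x ^ (j + 2))
      ((((j + 2 : ℕ) : ℝ) * excess Ω k v x ^ (j + 1)) • fderiv ℝ v x) x := by
  by_cases hx : x ∈ Ω
  · have he : (fun x => excess Ω k v x ^ (j + 2)) =ᶠ[nhds x]
        (fun s => max (s - k) 0 ^ (j + 2)) ∘ v := by
      filter_upwards [hΩ.mem_nhds hx] with y hy
      simp [excess_of_mem hy]
    rw [excess_of_mem hx]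
    exact ((hasDerivAt_max_sub_zero_pow k (v x) j).comp_hasFDerivAt x
      (hd x hx).hasFDerivAt).congr_of_eventuallyEq he
  · have hK := isCompact_superlevel (k := k) hΩb hv
    have he : (fun x => excess Ω k v x ^ (j + 2)) =ᶠ[nhds x] fun _ => 0 := by
      filter_upwards [hK.isClosed.isOpen_compl.mem_nhds
        (fun h => hx (superlevel_subset hΩ hb hk h))] with y hy
      simp [excess_eq_zero_of_notMem_superlevel hy]
    rw [excess_of_notMem hx]
    simpa using (hasFDerivAt_const (0 : ℝ) x).congr_of_eventuallyEq he

theorem divergence_smul {φ : EuclideanSpace ℝ (Fin n) → ℝ}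
    {F : EuclideanSpace ℝ (Fin n) → EuclideanSpace ℝ (Fin n)} {x : EuclideanSpace ℝ (Fin n)}
    (hφ : DifferentiableAt ℝ φ x) (hF : DifferentiableAt ℝ F x) :
    divergence (fun x => φ x • F x) x = φ x * divergence F x + fderiv ℝ φ x (F x) := by
  have h1 : fderiv ℝ φ x (F x) = ∑ i, fderiv ℝ φ x (EuclideanSpace.single i 1) * F x i := by
    conv_lhs => rw [← (EuclideanSpace.basisFun (Fin n) ℝ).sum_repr (F x)]
    simp [map_sum, mul_comm]
  rw [h1, divergence, divergence, Finset.mul_sum, ← Finset.sum_add_distrib]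
  refine Finset.sum_congr rfl fun i _ => ?_
  rw [fderiv_fun_smul hφ hF]
  simp

theorem fderiv_gradient_self (v : EuclideanSpace ℝ (Fin n) → ℝ) (x : EuclideanSpace ℝ (Fin n)) :
    fderiv ℝ v x (gradient v x) = ‖fderiv ℝ v x‖ ^ 2 := by
  have h1 : fderiv ℝ v x = InnerProductSpace.toDual ℝ _ (gradient v x) := by simp [gradient]
  have h2 : ‖fderiv ℝ v x‖ = ‖gradient v x‖ := by simp [gradient]
  rw [h2, h1, InnerProductSpace.toDual_apply_apply, real_inner_self_eq_norm_sq]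

theorem continuousOn_fderiv_of_gradient {s : Set (EuclideanSpace ℝ (Fin n))}
    (h : ContinuousOn (gradient v) s) : ContinuousOn (fderiv ℝ v) s := by
  have h1 : fderiv ℝ v = fun x => InnerProductSpace.toDual ℝ _ (gradient v x) := by
    ext1 x; simp [gradient]
  rw [h1]
  exact (InnerProductSpace.toDual ℝ _).continuous.comp_continuousOn h

theorem excess_sq_contDiff (hΩ : IsOpen Ω) (hΩb : Bornology.IsBounded Ω)
    (hv : ContinuousOn v (closure Ω)) (hb : ∀ x ∈ frontier Ω, v x = 0) (hk : 0 < k)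
    (hd : ∀ x ∈ Ω, DifferentiableAt ℝ v x) (hg : ContinuousOn (fderiv ℝ v) Ω) :
    ContDiff ℝ 1 (fun x => excess Ω k v x ^ 2) := by
  have hF := hasFDerivAt_excess_pow hΩ hΩb hv hb hk hd 0
  rw [contDiff_one_iff_fderiv]
  refine ⟨fun x => (hF x).differentiableAt, ?_⟩
  have h1 : (fderiv ℝ fun x => excess Ω k v x ^ 2) = fun x =>
      excess Ω k v x ^ (0 + 1) • ((2 : ℝ) • fderiv ℝ v x) := by
    ext1 x
    rw [(hF x).fderiv, smul_smul]
    simp [mul_comm]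
  rw [h1]
  exact (continuous_excess_pow_smul hΩ hΩb hv hb hk (hg.const_smul (2 : ℝ)) 0).1

/-- Testing a divergence-form operator with the third power of the excess. -/
theorem integral_excess_cube_mul_divergence_le (hn : 0 < n) (hΩ : IsOpen Ω)
    (hΩb : Bornology.IsBounded Ω)
    (hv : ContinuousOn v (closure Ω)) (hb : ∀ x ∈ frontier Ω, v x = 0) (hk : 0 < k)
    (hd : ∀ x ∈ Ω, DifferentiableAt ℝ v x) (hg : ContinuousOn (gradient v) Ω)
    {A : EuclideanSpace ℝ (Fin n) → ℝ} {m : ℝ} (hA : ∀ x ∈ Ω, m ≤ A x)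
    (hq : ∀ x ∈ Ω, DifferentiableAt ℝ (fun x => A x • gradient v x) x)
    (hi : Integrable fun x => excess Ω k v x ^ 3 * divergence (fun x => A x • gradient v x) x) :
    4 * ∫ x, excess Ω k v x ^ 3 * divergence (fun x => A x • gradient v x) x ≤
      -(3 * m) * ∫ x, ‖fderiv ℝ (fun x => excess Ω k v x ^ 2) x‖ ^ 2 := by
  set q := fun x => A x • gradient v x with hqdef
  have hg' := continuousOn_fderiv_of_gradient hg
  have hqc : ContinuousOn q Ω := fun x hx => (hq x hx).continuousAt.continuousWithinAt
  have hF2 := hasFDerivAt_excess_pow hΩ hΩb hv hb hk hd 0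
  have hF3 := hasFDerivAt_excess_pow hΩ hΩb hv hb hk hd 1
  have hK := isCompact_superlevel (k := k) hΩb hv
  have hKΩ := superlevel_subset hΩ hb hk
  have hVd : Differentiable ℝ fun x => excess Ω k v x ^ 3 • q x := by
    intro x
    by_cases hx : x ∈ Ω
    · exact (hF3 x).differentiableAt.smul (hq x hx)
    · have he : (fun x => excess Ω k v x ^ 3 • q x) =ᶠ[nhds x] fun _ => 0 := by
        filter_upwards [hK.isClosed.isOpen_compl.mem_nhds (fun h => hx (hKΩ h))] with y hy
        simp [excess_eq_zero_of_notMem_superlevel hy]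
      exact (differentiableAt_const _).congr_of_eventuallyEq he
  have hdiv : divergence (fun x => excess Ω k v x ^ 3 • q x) = fun x =>
      excess Ω k v x ^ 3 * divergence q x +
        excess Ω k v x ^ (1 + 1) • (3 * fderiv ℝ v x (q x)) := by
    ext1 x
    by_cases hx : x ∈ Ω
    · rw [divergence_smul (hF3 x).differentiableAt (hq x hx), (hF3 x).fderiv]
      simp only [Nat.cast_ofNat, smul_apply, smul_eq_mul, Nat.reduceAdd]
      ring
    · have he : (fun x => excess Ω k v x ^ 3 • q x) =ᶠ[nhds x] fun _ => 0 := by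
        filter_upwards [hK.isClosed.isOpen_compl.mem_nhds (fun h => hx (hKΩ h))] with y hy
        simp [excess_eq_zero_of_notMem_superlevel hy]
      rw [divergence, he.fderiv_eq]
      simp [excess_of_notMem hx]
  have hcq : ContinuousOn (fun x => 3 * fderiv ℝ v x (q x)) Ω :=
    continuousOn_const.mul (hg'.clm_apply hqc)
  have hc2 := continuous_excess_pow_smul hΩ hΩb hv hb hk hcq 1
  have hi2 := hc2.1.integrable_of_hasCompactSupport hc2.2 (μ := volume)
  have h0 := integral_divergence_eq_zero hn hVd
    (continuous_excess_pow_smul hΩ hΩb hv hb hk hqc 2).2 (by rw [hdiv]; exact hi.add hi2)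
  rw [hdiv, integral_add hi hi2] at h0
  have hcd := excess_sq_contDiff hΩ hΩb hv hb hk hd hg'
  have hcs : HasCompactSupport (fun x => excess Ω k v x ^ 2) := by
    simpa using (continuous_excess_pow_smul hΩ hΩb hv hb hk (h := fun _ => (1 : ℝ))
      continuousOn_const 1).2
  have hi3 : Integrable fun x => ‖fderiv ℝ (fun x => excess Ω k v x ^ 2) x‖ ^ 2 := by
    refine Continuous.integrable_of_hasCompactSupport
      ((hcd.continuous_fderiv one_ne_zero).norm.pow 2) ?_
    exact (hcs.fderiv ℝ).comp_left (g := fun L => ‖L‖ ^ 2) (by simp)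
  -- Since `∇(z²) = 2z ∇v`, both sides carry the same factor: `3m |∇(z²)|² = 12 m z² |∇v|² ≤ 12 A z²
  -- |∇v|²`.
  have hle : ∫ x, (3 * m) * ‖fderiv ℝ (fun x => excess Ω k v x ^ 2) x‖ ^ 2 ≤
      ∫ x, 4 * (excess Ω k v x ^ (1 + 1) • (3 * fderiv ℝ v x (q x))) := by
    refine integral_mono (hi3.const_mul _) (hi2.const_mul _) fun x => ?_
    simp only [(hF2 x).fderiv]
    by_cases hx : x ∈ Ω
    · have e1 : fderiv ℝ v x (q x) = A x * ‖fderiv ℝ v x‖ ^ 2 := by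
        rw [hqdef]
        simp only [map_smul, smul_eq_mul, fderiv_gradient_self]
      rw [e1, norm_smul, mul_pow]
      simp only [norm_mul, Real.norm_eq_abs, zero_add, pow_one, Nat.cast_ofNat, smul_eq_mul,
        abs_of_nonneg (excess_nonneg x), Nat.abs_ofNat, Nat.reduceAdd]
      have := mul_le_mul_of_nonneg_right (hA x hx)
        (show 0 ≤ 12 * (excess Ω k v x ^ 2 * ‖fderiv ℝ v x‖ ^ 2) by positivity)
      linarith
    · simp [excess_of_notMem hx]
  rw [integral_const_mul, integral_const_mul] at hle
  linarith

end Excess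

/-! ### Sobolev, Hölder and Young estimates at a fixed time. -/

/-- Hölder on the support; this is how powers of the level-set measure enter. -/
theorem toReal_eLpNorm_le_mul_rpow_of_measure_support_le {X : Type*} [MeasurableSpace X]
    {ν : Measure X} {z : X → ℝ} {s P μ : ℝ}
    (hP : MemLp z (ENNReal.ofReal P) ν) (hs : 0 < s) (hsP : s ≤ P) (hμ : 0 < μ)
    (hsupp : ν (Function.support z) ≤ ENNReal.ofReal μ) :
    (eLpNorm z (ENNReal.ofReal s) ν).toReal ≤
      (eLpNorm z (ENNReal.ofReal P) ν).toReal * μ ^ (1 / s - 1 / P) := by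
  have hP0 : 0 < P := hs.trans_le hsP
  have h := eLpNorm_le_eLpNorm_mul_rpow_measure_univ (ENNReal.ofReal_le_ofReal hsP)
    (hP.1.restrict (s := Function.support z))
  rw [eLpNorm_restrict_eq_of_support_subset subset_rfl,
    eLpNorm_restrict_eq_of_support_subset subset_rfl, Measure.restrict_apply_univ,
    ENNReal.toReal_ofReal hs.le, ENNReal.toReal_ofReal hP0.le] at h
  have he : 0 ≤ 1 / s - 1 / P := sub_nonneg.2 (one_div_le_one_div_of_le hs hsP)
  have h2 := h.trans (mul_le_mul_right (ENNReal.rpow_le_rpow hsupp he) _)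
  rw [ENNReal.ofReal_rpow_of_pos hμ] at h2
  have h3 := ENNReal.toReal_mono (ENNReal.mul_ne_top hP.2.ne ENNReal.ofReal_ne_top) h2
  rwa [ENNReal.toReal_mul, ENNReal.toReal_ofReal (by positivity)] at h3

theorem integral_norm_pow_eq_toReal_eLpNorm_pow {X H : Type*} [MeasurableSpace X]
    [NormedAddCommGroup H] {ν : Measure X}
    {z : X → H} {j : ℕ} (hj : j ≠ 0) (hz : MemLp z (j : ℝ≥0∞) ν) :
    ∫ x, ‖z x‖ ^ j ∂ν = (eLpNorm z (j : ℝ≥0∞) ν).toReal ^ j := by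
  have hI : 0 ≤ ∫ x, ‖z x‖ ^ j ∂ν := integral_nonneg fun x => by positivity
  rw [hz.eLpNorm_eq_integral_rpow_norm (by simpa using hj) (by simp)]
  simp only [ENNReal.toReal_natCast, Real.rpow_natCast]
  rw [ENNReal.toReal_ofReal (by positivity), Real.rpow_inv_natCast_pow hI hj]

section

variable {n : ℕ}

/-- The Sobolev inequality for the square of a nonnegative function. -/
theorem exists_toReal_eLpNorm_pow_four_le (hn : 3 ≤ n) :
    ∃ S > 0, ∀ z : EuclideanSpace ℝ (Fin n) → ℝ, (∀ x, 0 ≤ z x) → HasCompactSupport z →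
      ContDiff ℝ 1 (fun x => z x ^ 2) →
      (eLpNorm z (ENNReal.ofReal (4 * n / (n - 2))) volume).toReal ^ 4 ≤
        S * ∫ x, ‖fderiv ℝ (fun x => z x ^ 2) x‖ ^ 2 := by
  have hn' : (3 : ℝ) ≤ n := by exact_mod_cast hn
  set c := eLpNormLESNormFDerivOfEqInnerConst (volume : Measure (EuclideanSpace ℝ (Fin n)))
    ((2 : NNReal) : ℝ) with hc
  refine ⟨(c : ℝ) ^ 2 + 1, by positivity, fun z hz0 hzs hcd => ?_⟩
  have hws : HasCompactSupport fun x => z x ^ 2 := hzs.comp_left (g := fun s => s ^ 2) (by simp)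
  have h := eLpNorm_le_eLpNorm_fderiv_of_eq_inner (μ := volume) (p := 2)
    (p' := Real.toNNReal (2 * n / (n - 2))) hcd hws (by norm_num)
    (by rw [finrank_euclideanSpace_fin]; omega) (by
      rw [finrank_euclideanSpace_fin, Real.coe_toNNReal _ (by
        apply div_nonneg <;> linarith)]
      have : (n : ℝ) - 2 ≠ 0 := by linarith
      push_cast
      field_simp)
  rw [← hc] at h
  have e1 : (fun x => z x ^ 2) = fun x => ‖z x‖ ^ (2 : ℝ) := by
    ext1 x; simp
  -- The Sobolev exponent `2n/(n-2)` of `z²` doubles to `4n/(n-2)` for `z`. Squaring the Sobolev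
  -- inequality then produces the fourth power.
  have e2 : eLpNorm (fun x => z x ^ 2) ((Real.toNNReal (2 * n / (n - 2)) : NNReal) : ℝ≥0∞) volume =
      eLpNorm z (ENNReal.ofReal (4 * n / (n - 2))) volume ^ 2 := by
    rw [e1, eLpNorm_norm_rpow z two_pos]
    change eLpNorm z (ENNReal.ofReal _ * _) volume ^ (2 : ℝ) = _
    rw [← ENNReal.ofReal_mul (by apply div_nonneg <;> linarith), ENNReal.rpow_two]
    congr 3
    ring
  have hD : MemLp (fderiv ℝ fun x => z x ^ 2) ((2 : ℕ) : ℝ≥0∞) volume :=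
    (hcd.continuous_fderiv one_ne_zero).memLp_of_hasCompactSupport (hws.fderiv ℝ)
  rw [e2] at h
  have h2 := ENNReal.toReal_mono (ENNReal.mul_ne_top ENNReal.coe_ne_top hD.2.ne) h
  rw [ENNReal.toReal_mul, ENNReal.toReal_pow, ENNReal.coe_toReal] at h2
  have h3 := pow_le_pow_left₀ (by positivity) h2 2
  rw [mul_pow, ← integral_norm_pow_eq_toReal_eLpNorm_pow two_ne_zero hD, ← pow_mul] at h3
  refine h3.trans ?_
  have : 0 ≤ ∫ x, ‖fderiv ℝ (fun x => z x ^ 2) x‖ ^ 2 := integral_nonneg fun x => by positivity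
  nlinarith

theorem integral_cube_mul_le {Ω : Set (EuclideanSpace ℝ (Fin n))}
    {p q F : ℝ} (hpq : p.HolderConjugate q) (hF : 0 ≤ F)
    {f z : EuclideanSpace ℝ (Fin n) → ℝ}
    (hf : AEStronglyMeasurable f (volume.restrict Ω))
    (hfF : eLpNorm f (ENNReal.ofReal q) (volume.restrict Ω) ≤ ENNReal.ofReal F)
    (hz : Continuous z) (hzc : HasCompactSupport z) (hz0 : ∀ x, x ∉ Ω → z x = 0) :
    ∫ x, z x ^ 3 * f x ≤
      F * (eLpNorm z (ENNReal.ofReal (3 * p)) volume).toReal ^ 3 := by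
  have := hpq.symm.ennrealOfReal
  have hp0 := hpq.pos
  rw [← setIntegral_eq_integral_of_forall_compl_eq_zero (s := Ω)
    (fun x hx => by simp [hz0 x hx])]
  have h1 := eLpNorm_smul_le_mul_eLpNorm (r := 1) (p := ENNReal.ofReal q) (q := ENNReal.ofReal p)
    (μ := volume.restrict Ω)
    (f := fun x => ‖z x‖ ^ (3 : ℝ)) (φ := f)
    (by
      have : Continuous fun x => ‖z x‖ ^ (3 : ℝ) := hz.norm.rpow_const fun _ => Or.inr (by norm_num)
      exact this.aestronglyMeasurable) hf
  have h2 : eLpNorm (fun x => ‖z x‖ ^ (3 : ℝ)) (ENNReal.ofReal p) (volume.restrict Ω) ≤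
      eLpNorm z (ENNReal.ofReal (3 * p)) volume ^ 3 := by
    rw [eLpNorm_norm_rpow z three_pos, ← ENNReal.ofReal_mul hp0.le, mul_comm p 3]
    have : (eLpNorm z (ENNReal.ofReal (3 * p)) (volume.restrict Ω)) ≤
      (eLpNorm z (ENNReal.ofReal (3 * p)) volume) := eLpNorm_mono_measure _ Measure.restrict_le_self
    calc _ ≤ eLpNorm z (ENNReal.ofReal (3 * p)) volume ^ (3 : ℝ) :=
          ENNReal.rpow_le_rpow this (by norm_num)
      _ = _ := by rw [← ENNReal.rpow_natCast]; norm_num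
  have hN : eLpNorm z (ENNReal.ofReal (3 * p)) volume ≠ ∞ :=
    (hz.memLp_of_hasCompactSupport hzc).2.ne
  have h3 := ENNReal.toReal_mono
    (ENNReal.mul_ne_top ENNReal.ofReal_ne_top (ENNReal.pow_ne_top hN))
    (h1.trans (mul_le_mul' hfF h2))
  rw [ENNReal.toReal_mul, ENNReal.toReal_pow, ENNReal.toReal_ofReal hF,
    eLpNorm_one_eq_lintegral_enorm] at h3
  refine (le_abs_self _).trans (le_trans ?_ h3)
  refine (norm_integral_le_lintegral_norm (μ := volume.restrict Ω)
    (fun x => z x ^ 3 * f x)).trans (le_of_eq ?_)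
  congr 2
  ext1 x
  rw [ofReal_norm, enorm_mul, Pi.smul_apply', enorm_smul, mul_comm]
  congr 1
  rw [← enorm_norm]
  norm_num

/-- Young's inequality with explicit constants: either `2B ≤ cN`, and the first term dominates, or
`N ≤ 2B/c`, and the second does. -/
theorem four_mul_mul_cube_le {c B N : ℝ} (hc : 0 < c) (hB : 0 ≤ B) (hN : 0 ≤ N) :
    4 * B * N ^ 3 ≤ 2 * c * N ^ 4 + 32 * B ^ 4 / c ^ 3 := by
  rcases le_total (2 * B) (c * N) with h | h
  · have h1 : 2 * B * N ^ 3 ≤ c * N * N ^ 3 := by gcongr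
    have h2 : 0 ≤ 32 * B ^ 4 / c ^ 3 := by positivity
    nlinarith
  · have h1 : N ≤ 2 * B / c := by rw [le_div_iff₀ hc]; linarith
    calc 4 * B * N ^ 3 ≤ 4 * B * (2 * B / c) ^ 3 := by gcongr
      _ = 32 * B ^ 4 / c ^ 3 := by field_simp; ring
      _ ≤ _ := by
        have : 0 ≤ 2 * c * N ^ 4 := by positivity
        linarith

/-- The differential inequality for the fourth power of the excess, at a fixed time, in terms of a
bound `μ` for the measure of the level set. -/
theorem exists_integral_excess_cube_mul_le (hn : 3 ≤ n) {Ω : Set (EuclideanSpace ℝ (Fin n))}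
    (hΩ : IsOpen Ω) (hΩb : Bornology.IsBounded Ω) {p q F m : ℝ} (hpq : p.HolderConjugate q)
    (hpn : p < (n : ℝ) / ((n : ℝ) - 2)) (hF : 0 ≤ F) (hm : 0 < m) :
    ∃ C > 0, ∀ μ > 0, ∃ l : ℝ, ∀ (k : ℝ) (v A f dv : EuclideanSpace ℝ (Fin n) → ℝ),
      0 < k → ContinuousOn v (closure Ω) → (∀ x ∈ frontier Ω, v x = 0) →
      (∀ x ∈ Ω, DifferentiableAt ℝ v x) → ContinuousOn (gradient v) Ω →
      (∀ x ∈ Ω, m ≤ A x) → (∀ x ∈ Ω, DifferentiableAt ℝ (fun x => A x • gradient v x) x) →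
      ContinuousOn dv Ω →
      (∀ x ∈ Ω, dv x - divergence (fun x => A x • gradient v x) x = f x) →
      AEStronglyMeasurable f (volume.restrict Ω) →
      eLpNorm f (ENNReal.ofReal q) (volume.restrict Ω) ≤ ENNReal.ofReal F →
      volume {x | x ∈ Ω ∧ k < v x} ≤ ENNReal.ofReal μ →
      4 * ∫ x, excess Ω k v x ^ 3 * dv x ≤
        l * (C * μ ^ (1 + 4 * (1 / p - ((n : ℝ) - 2) / n)) - ∫ x, excess Ω k v x ^ 4) := by
  obtain ⟨S, hS, hSob⟩ := exists_toReal_eLpNorm_pow_four_le hn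
  have hn' : (3 : ℝ) ≤ n := by exact_mod_cast hn
  have hp0 := hpq.pos
  set c := m / S with hc
  have hc0 : 0 < c := by positivity
  -- `C` is Young's `32 F⁴ / c³` divided by the factor `c` of the rate `l`; adding `1` keeps it
  -- positive when `F = 0`. Only `l` depends on `μ`, which the iteration allows because Gronwall's
  -- bound does not involve `l`.
  refine ⟨32 * F ^ 4 / c ^ 4 + 1, by positivity, fun μ hμ => ⟨c * μ ^ (-(2 / (n : ℝ))), ?_⟩⟩
  intro k v A f dv hk hv hb hd hg hA hq hdv heq hf hfF hlev
  set z := excess Ω k v with hz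
  obtain ⟨hzc, hzs⟩ := continuous_excess hΩ hΩb hv hb hk
  rw [← hz] at hzc hzs
  have hz0 : ∀ x, 0 ≤ z x := excess_nonneg
  have hzoff : ∀ x, x ∉ Ω → z x = 0 := fun x hx => excess_of_notMem hx
  set P : ℝ := 4 * n / (n - 2) with hP
  have hn2 : (0 : ℝ) < n - 2 := by linarith
  have h4P : 4 ≤ P := by rw [hP, le_div_iff₀ hn2]; linarith
  have h3P : 3 * p ≤ P := by
    have : 3 * p ≤ 3 * (n / (n - 2)) := by linarith
    refine this.trans ?_
    rw [hP, mul_div_assoc]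
    have : (0 : ℝ) ≤ n / (n - 2) := by positivity
    linarith
  set N := (eLpNorm z (ENNReal.ofReal P) volume).toReal with hN
  have hN0 : 0 ≤ N := ENNReal.toReal_nonneg
  have hsupp : volume (Function.support z) ≤ ENNReal.ofReal μ := by
    refine (measure_mono fun x hx => ?_).trans hlev
    have hxΩ : x ∈ Ω := by
      by_contra h
      exact hx (hzoff x h)
    refine ⟨hxΩ, ?_⟩
    by_contra h
    apply hx
    rw [hz, excess_of_mem hxΩ, max_eq_right (by linarith)]
  have hy : ∫ x, z x ^ 4 ≤ N ^ 4 * μ ^ (2 / (n : ℝ)) := by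
    have h1 := integral_norm_pow_eq_toReal_eLpNorm_pow (z := z) (ν := volume) four_ne_zero
      (hzc.memLp_of_hasCompactSupport hzs)
    have h2 := toReal_eLpNorm_le_mul_rpow_of_measure_support_le
      (hzc.memLp_of_hasCompactSupport hzs) four_pos h4P hμ hsupp
    have h3 : ∫ x, z x ^ 4 = ∫ x, ‖z x‖ ^ 4 := by
      simp_rw [Real.norm_eq_abs, abs_of_nonneg (hz0 _)]
    rw [h3, h1]
    have h4 : ((4 : ℕ) : ℝ≥0∞) = ENNReal.ofReal 4 := by simp
    rw [h4]
    refine (pow_le_pow_left₀ ENNReal.toReal_nonneg h2 4).trans (le_of_eq ?_)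
    rw [mul_pow, ← Real.rpow_natCast (μ ^ _), ← Real.rpow_mul hμ.le]
    congr 2
    rw [hP]
    field_simp
    ring
  -- `β = 3 (1/(3p) - 1/P)`, from Hölder between `L^(3p)` and `L^P`. Here `3p ≤ P` follows from `p <
  -- n/(n-2)`.
  set β : ℝ := 1 / p - 3 * (n - 2) / (4 * n) with hβ
  have hI : ∫ x, z x ^ 3 * f x ≤ F * μ ^ β * N ^ 3 := by
    refine (integral_cube_mul_le hpq hF hf hfF hzc hzs hzoff).trans ?_
    have h2 := toReal_eLpNorm_le_mul_rpow_of_measure_support_le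
      (hzc.memLp_of_hasCompactSupport hzs) (by positivity) h3P hμ hsupp
    have h3 := pow_le_pow_left₀ ENNReal.toReal_nonneg h2 3
    have e : (μ ^ (1 / (3 * p) - 1 / P)) ^ 3 = μ ^ β := by
      rw [← Real.rpow_natCast (μ ^ _), ← Real.rpow_mul hμ.le]
      congr 1
      rw [hP, hβ]
      push_cast
      field_simp
    rw [mul_pow, e] at h3
    calc _ ≤ F * (N ^ 3 * μ ^ β) := by gcongr
      _ = _ := by ring
  have hvol : volume Ω < ∞ := hΩb.measure_lt_top
  have : IsFiniteMeasure (volume.restrict Ω) := ⟨by simpa using hvol⟩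
  have hfi : Integrable f (volume.restrict Ω) :=
    MemLp.integrable (ENNReal.one_le_ofReal.2 hpq.symm.lt.le)
      ⟨hf, hfF.trans_lt ENNReal.ofReal_lt_top⟩
  obtain ⟨Cz, hCz⟩ := hzc.bounded_above_of_compact_support hzs
  have hi1 : Integrable fun x => z x ^ 3 * f x := by
    rw [← integrableOn_iff_integrable_of_support_subset (s := Ω)]
    · refine hfi.bdd_mul (c := Cz ^ 3) (hzc.pow 3).aestronglyMeasurable
        (Filter.Eventually.of_forall fun x => ?_)
      rw [norm_pow]
      exact pow_le_pow_left₀ (norm_nonneg _) (hCz x) 3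
    · intro x hx
      by_contra h
      exact hx (by simp [hzoff x h])
  have hi2 : Integrable fun x => z x ^ 3 * dv x := by
    have := continuous_excess_pow_smul hΩ hΩb hv hb hk hdv 2
    exact this.1.integrable_of_hasCompactSupport this.2
  -- Integrability of the divergence term is read off from the equation, since `z³ dv` and `z³ f`
  -- are integrable.
  have hdivz : (fun x => z x ^ 3 * divergence (fun x => A x • gradient v x) x) =
      fun x => z x ^ 3 * dv x - z x ^ 3 * f x := by
    ext1 x
    by_cases hx : x ∈ Ω
    · rw [← heq x hx]; ring
    · simp [hzoff x hx]
  have hE := integral_excess_cube_mul_divergence_le (by omega) hΩ hΩb hv hb hk hd hg hA hq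
    (by rw [← hz, hdivz]; exact hi2.sub hi1)
  rw [← hz, hdivz, integral_sub hi2 hi1] at hE
  have hSz := hSob z hz0 hzs
    (excess_sq_contDiff hΩ hΩb hv hb hk hd (continuousOn_fderiv_of_gradient hg))
  rw [← hN] at hSz
  set G := ∫ x, ‖fderiv ℝ (fun x => z x ^ 2) x‖ ^ 2
  have hcG : c * N ^ 4 ≤ m * G := by
    rw [hc, div_mul_eq_mul_div, div_le_iff₀ hS]
    nlinarith
  -- Dissipation supplies `3c N⁴`: Young absorbs `2c N⁴`, and the remaining `c N⁴` controls `l ∫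
  -- z⁴`.
  have hY := four_mul_mul_cube_le hc0 (show 0 ≤ F * μ ^ β by positivity) hN0
  have hμ2 : c * μ ^ (-(2 / (n : ℝ))) * ∫ x, z x ^ 4 ≤ c * N ^ 4 := by
    rw [mul_assoc]
    refine mul_le_mul_of_nonneg_left ?_ hc0.le
    rw [Real.rpow_neg hμ.le, inv_mul_le_iff₀ (by positivity)]
    linarith
  have hpow : 32 * (F * μ ^ β) ^ 4 / c ^ 3 ≤ c * μ ^ (-(2 / (n : ℝ))) *
      ((32 * F ^ 4 / c ^ 4 + 1) * μ ^ (1 + 4 * (1 / p - ((n : ℝ) - 2) / n))) := by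
    have e : μ ^ (1 + 4 * (1 / p - ((n : ℝ) - 2) / n)) = (μ ^ β) ^ 4 * μ ^ (2 / (n : ℝ)) := by
      rw [← Real.rpow_natCast (μ ^ _), ← Real.rpow_mul hμ.le, ← Real.rpow_add hμ]
      congr 1
      rw [hβ]
      push_cast
      field_simp
      ring
    have hμ' : 0 < μ ^ (2 / (n : ℝ)) := by positivity
    rw [e, Real.rpow_neg hμ.le]
    have : 0 ≤ c * (μ ^ β) ^ 4 := by positivity
    calc _ = 32 * F ^ 4 / c ^ 3 * (μ ^ β) ^ 4 := by ring
      _ ≤ 32 * F ^ 4 / c ^ 3 * (μ ^ β) ^ 4 + c * (μ ^ β) ^ 4 := by linarith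
      _ = _ := by field_simp
  rw [mul_sub]
  linarith

end

/-! ### Evolution of the excess in time and the uniform one-sided bound. -/

section LinearSolution

variable {n : ℕ}

/-- Classical solutions of a linear coercive divergence-form equation with zero boundary values. -/
structure IsLinearSolution (Ω : Set (EuclideanSpace ℝ (Fin n))) (T : EReal) (m : ℝ)
    (f v : ℝ → EuclideanSpace ℝ (Fin n) → ℝ) : Prop where
  continuousOn : ContinuousOn (fun z : ℝ × EuclideanSpace ℝ (Fin n) => v z.1 z.2)
    (timeIco T ×ˢ closure Ω)
  differentiableAt_time : ∀ t ∈ timeIoo T, ∀ x ∈ Ω, DifferentiableAt ℝ (fun s => v s x) t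
  continuousOn_deriv_time :
    ContinuousOn (fun z : ℝ × EuclideanSpace ℝ (Fin n) => deriv (fun s => v s z.2) z.1)
      (timeIoo T ×ˢ Ω)
  differentiableAt_space : ∀ t ∈ timeIoo T, ∀ x ∈ Ω, DifferentiableAt ℝ (v t) x
  continuousOn_gradient : ∀ t ∈ timeIoo T, ContinuousOn (gradient (v t)) Ω
  exists_coefficient : ∀ t ∈ timeIoo T, ∃ A : EuclideanSpace ℝ (Fin n) → ℝ, (∀ x ∈ Ω, m ≤ A x) ∧
    (∀ x ∈ Ω, DifferentiableAt ℝ (fun x => A x • gradient (v t) x) x) ∧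
    ∀ x ∈ Ω, deriv (fun s => v s x) t - divergence (fun x => A x • gradient (v t) x) x = f t x
  boundary : ∀ t ∈ timeIoo T, ∀ x ∈ frontier Ω, v t x = 0

theorem timeIoo_subset (T : EReal) : timeIoo T ⊆ timeIco T := fun _ h => ⟨h.1.le, h.2⟩

theorem mem_timeIco_of_le {T : EReal} {s b : ℝ} (hs : 0 ≤ s) (hsb : s ≤ b) (hb : b ∈ timeIco T) :
    s ∈ timeIco T := ⟨hs, (EReal.coe_le_coe_iff.2 hsb).trans_lt hb.2⟩

theorem mem_timeIoo_of_le {T : EReal} {s b : ℝ} (hs : 0 < s) (hsb : s ≤ b) (hb : b ∈ timeIco T) :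
    s ∈ timeIoo T := ⟨hs, (EReal.coe_le_coe_iff.2 hsb).trans_lt hb.2⟩

variable {Ω : Set (EuclideanSpace ℝ (Fin n))} {T : EReal} {m : ℝ}
  {f v : ℝ → EuclideanSpace ℝ (Fin n) → ℝ}

namespace IsLinearSolution

theorem continuousOn_space (hv : IsLinearSolution Ω T m f v) {t : ℝ} (ht : t ∈ timeIco T) :
    ContinuousOn (v t) (closure Ω) :=
  hv.continuousOn.comp (f := fun x => (t, x)) (by fun_prop) fun _ hx => ⟨ht, hx⟩

theorem exists_bound (hv : IsLinearSolution Ω T m f v) (hΩb : Bornology.IsBounded Ω) {b : ℝ}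
    (hb : b ∈ timeIco T) : ∃ B, ∀ t ∈ Icc 0 b, ∀ x ∈ Ω, |v t x| ≤ B := by
  have hK : IsCompact (Icc 0 b ×ˢ closure Ω) := isCompact_Icc.prod hΩb.isCompact_closure
  obtain ⟨B, hB⟩ := hK.exists_bound_of_continuousOn
    (hv.continuousOn.mono (prod_mono_left fun t ht => mem_timeIco_of_le ht.1 ht.2 hb))
  exact ⟨B, fun t ht x hx => hB (t, x) ⟨ht, subset_closure hx⟩⟩

theorem aestronglyMeasurable_max_pow (hv : IsLinearSolution Ω T m f v) (hΩ : IsOpen Ω) {t : ℝ}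
    (ht : t ∈ timeIco T) (k : ℝ) (j : ℕ) :
    AEStronglyMeasurable (fun x => max (v t x - k) 0 ^ j) (volume.restrict Ω) :=
  ContinuousOn.aestronglyMeasurable (((((hv.continuousOn_space ht).mono subset_closure).sub
    continuousOn_const).sup continuousOn_const).pow j) hΩ.measurableSet

theorem exists_max_pow_bound (hv : IsLinearSolution Ω T m f v) (hΩb : Bornology.IsBounded Ω)
    {b : ℝ} (hb : b ∈ timeIco T) (k : ℝ) (j : ℕ) :
    ∃ B, ∀ t ∈ Icc 0 b, ∀ x ∈ Ω, ‖max (v t x - k) 0 ^ j‖ ≤ B := by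
  obtain ⟨B, hB⟩ := hv.exists_bound hΩb hb
  refine ⟨(B + |k|) ^ j, fun t ht x hx => ?_⟩
  rw [norm_pow]
  refine pow_le_pow_left₀ (norm_nonneg _) ?_ j
  rw [Real.norm_eq_abs, abs_of_nonneg (le_max_right _ _)]
  have h1 := hB t ht x hx
  have h2 := neg_abs_le k
  have h3 := le_abs_self (v t x)
  have h4 := abs_nonneg (v t x)
  exact max_le (by linarith) (by linarith [abs_nonneg k])

theorem integrable_max_pow (hv : IsLinearSolution Ω T m f v) (hΩ : IsOpen Ω)
    (hΩb : Bornology.IsBounded Ω) {t : ℝ} (ht : t ∈ timeIco T) (k : ℝ) (j : ℕ) :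
    Integrable (fun x => max (v t x - k) 0 ^ j) (volume.restrict Ω) := by
  have : IsFiniteMeasure (volume.restrict Ω) := ⟨by simpa using hΩb.measure_lt_top⟩
  obtain ⟨B, hB⟩ := hv.exists_max_pow_bound hΩb ht k j
  exact (integrable_const B).mono' (hv.aestronglyMeasurable_max_pow hΩ ht k j)
    ((ae_restrict_iff' hΩ.measurableSet).2
      (Filter.Eventually.of_forall fun x hx => hB t ⟨ht.1, le_rfl⟩ x hx))

theorem continuousOn_integral_max_pow (hv : IsLinearSolution Ω T m f v) (hΩ : IsOpen Ω)
    (hΩb : Bornology.IsBounded Ω) {b : ℝ} (hb : b ∈ timeIco T) (k : ℝ) (j : ℕ) :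
    ContinuousOn (fun t => ∫ x in Ω, max (v t x - k) 0 ^ j) (Icc 0 b) := by
  have : IsFiniteMeasure (volume.restrict Ω) := ⟨by simpa using hΩb.measure_lt_top⟩
  obtain ⟨B, hB⟩ := hv.exists_max_pow_bound hΩb hb k j
  have hsub : Icc 0 b ⊆ timeIco T := fun t ht => mem_timeIco_of_le ht.1 ht.2 hb
  intro t ht
  refine continuousWithinAt_of_dominated (bound := fun _ => B) ?_ ?_ (integrable_const B) ?_
  · filter_upwards [self_mem_nhdsWithin] with s hs
    exact hv.aestronglyMeasurable_max_pow hΩ (hsub hs) k j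
  · filter_upwards [self_mem_nhdsWithin] with s hs
    exact (ae_restrict_iff' hΩ.measurableSet).2
      (Filter.Eventually.of_forall fun x hx => hB s hs x hx)
  · refine (ae_restrict_iff' hΩ.measurableSet).2 (Filter.Eventually.of_forall fun x hx => ?_)
    have h1 : ContinuousOn (fun s => v s x) (Icc 0 b) :=
      hv.continuousOn.comp (f := fun s => (s, x)) (by fun_prop)
        fun s hs => ⟨hsub hs, subset_closure hx⟩
    exact (((h1.sub continuousOn_const).sup continuousOn_const).pow j) t ht

theorem continuousOn_max_pow_mul_deriv (hv : IsLinearSolution Ω T m f v) (k : ℝ) (j : ℕ) :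
    ContinuousOn (fun z : ℝ × EuclideanSpace ℝ (Fin n) =>
      max (v z.1 z.2 - k) 0 ^ j * deriv (fun s => v s z.2) z.1) (timeIoo T ×ˢ Ω) :=
  ((((hv.continuousOn.mono (prod_mono (timeIoo_subset T) subset_closure)).sub
    continuousOn_const).sup continuousOn_const).pow j).mul hv.continuousOn_deriv_time

/-- The time derivative may be unbounded near `∂Ω` or `t = 0`. On `[c, b]` the set where `v ≥ k` is
compact inside `(0, T) × Ω`, and elsewhere the product vanishes. -/
theorem exists_max_pow_mul_deriv_bound (hv : IsLinearSolution Ω T m f v) (hΩ : IsOpen Ω)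
    (hΩb : Bornology.IsBounded Ω) {b c : ℝ} (hb : b ∈ timeIco T) (hc : 0 < c) {k : ℝ} (hk : 0 < k)
    (j : ℕ) : ∃ B, ∀ t ∈ Icc c b, ∀ x ∈ Ω,
      ‖max (v t x - k) 0 ^ (j + 1) * deriv (fun s => v s x) t‖ ≤ B := by
  have hsub : Icc c b ⊆ timeIoo T := fun t ht => mem_timeIoo_of_le (hc.trans_le ht.1) ht.2 hb
  have hcpt : IsCompact (Icc c b ×ˢ closure Ω) := isCompact_Icc.prod hΩb.isCompact_closure
  have hcont := hv.continuousOn.mono (prod_mono_left (t := closure Ω)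
    (hsub.trans (timeIoo_subset T)))
  have hK : IsCompact ((Icc c b ×ˢ closure Ω) ∩
      (fun z : ℝ × EuclideanSpace ℝ (Fin n) => v z.1 z.2) ⁻¹' Ici k) :=
    hcpt.of_isClosed_subset (hcont.preimage_isClosed_of_isClosed hcpt.isClosed isClosed_Ici)
      inter_subset_left
  obtain ⟨B, hB⟩ := hK.exists_bound_of_continuousOn
    ((hv.continuousOn_max_pow_mul_deriv k (j + 1)).mono fun z hz =>
      ⟨hsub hz.1.1, superlevel_subset hΩ (hv.boundary _ (hsub hz.1.1)) hk ⟨hz.1.2, hz.2⟩⟩)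
  refine ⟨max B 0, fun t ht x hx => ?_⟩
  by_cases h : k ≤ v t x
  · exact (hB (t, x) ⟨⟨ht, subset_closure hx⟩, h⟩).trans (le_max_left _ _)
  · rw [max_eq_right (show v t x - k ≤ 0 by linarith)]
    simp

theorem aestronglyMeasurable_max_pow_mul_deriv (hv : IsLinearSolution Ω T m f v) (hΩ : IsOpen Ω)
    {t : ℝ} (ht : t ∈ timeIoo T) (k : ℝ) (j : ℕ) :
    AEStronglyMeasurable (fun x => max (v t x - k) 0 ^ j * deriv (fun s => v s x) t)
      (volume.restrict Ω) :=
  ContinuousOn.aestronglyMeasurable ((hv.continuousOn_max_pow_mul_deriv k j).comp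
    (f := fun x => (t, x)) (by fun_prop) fun _ hx => ⟨ht, hx⟩) hΩ.measurableSet

/-- Continuity of the derivative is recorded because the differential inequality is available only
for almost every time. -/
theorem hasDerivAt_integral_max_pow (hv : IsLinearSolution Ω T m f v) (hΩ : IsOpen Ω)
    (hΩb : Bornology.IsBounded Ω) {b : ℝ} (hb : b ∈ timeIco T) {k : ℝ} (hk : 0 < k) {t : ℝ}
    (ht : t ∈ Ioo 0 b) :
    HasDerivAt (fun t => ∫ x in Ω, max (v t x - k) 0 ^ 4)
      (4 * ∫ x in Ω, max (v t x - k) 0 ^ 3 * deriv (fun s => v s x) t) t ∧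
    ContinuousAt (fun t => 4 * ∫ x in Ω, max (v t x - k) 0 ^ 3 * deriv (fun s => v s x) t) t := by
  have : IsFiniteMeasure (volume.restrict Ω) := ⟨by simpa using hΩb.measure_lt_top⟩
  have hs : Ioo (t / 2) b ∈ nhds t := Ioo_mem_nhds (by linarith [ht.1]) ht.2
  have h2 : 0 < t / 2 := by linarith [ht.1]
  have hsub : Ioo (t / 2) b ⊆ timeIoo T := fun s hs =>
    mem_timeIoo_of_le (h2.trans hs.1) hs.2.le hb
  have htI : t ∈ timeIoo T := hsub (mem_of_mem_nhds hs)
  obtain ⟨B, hB⟩ := hv.exists_max_pow_mul_deriv_bound hΩ hΩb hb h2 hk 2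
  constructor
  · rw [← integral_const_mul]
    refine (hasDerivAt_integral_of_dominated_loc_of_deriv_le (bound := fun _ => 4 * B)
      (F := fun t x => max (v t x - k) 0 ^ 4)
      (F' := fun t x => 4 * (max (v t x - k) 0 ^ 3 * deriv (fun s => v s x) t)) hs ?_
      (hv.integrable_max_pow hΩ hΩb (timeIoo_subset T htI) k 4)
      ((hv.aestronglyMeasurable_max_pow_mul_deriv hΩ htI k 3).const_mul 4) ?_
      (integrable_const _) ?_).2
    · filter_upwards [hs] with s hs
      exact hv.aestronglyMeasurable_max_pow hΩ (timeIoo_subset T (hsub hs)) k 4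
    · refine (ae_restrict_iff' hΩ.measurableSet).2
        (Filter.Eventually.of_forall fun x hx s hs => ?_)
      rw [norm_mul, Real.norm_ofNat]
      have := hB s ⟨hs.1.le, hs.2.le⟩ x hx
      gcongr
    · refine (ae_restrict_iff' hΩ.measurableSet).2
        (Filter.Eventually.of_forall fun x hx s hs => ?_)
      have h1 := (hasDerivAt_max_sub_zero_pow k (v s x) 2).comp s
        (hv.differentiableAt_time s (hsub hs) x hx).hasDerivAt
      refine h1.congr_deriv ?_
      push_cast
      ring
  · refine continuousAt_const.mul ?_
    refine continuousAt_of_dominated (bound := fun _ => B) ?_ ?_ (integrable_const B) ?_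
    · filter_upwards [hs] with s hs
      exact hv.aestronglyMeasurable_max_pow_mul_deriv hΩ (hsub hs) k 3
    · filter_upwards [hs] with s hs
      exact (ae_restrict_iff' hΩ.measurableSet).2
        (Filter.Eventually.of_forall fun x hx => hB s ⟨hs.1.le, hs.2.le⟩ x hx)
    · refine (ae_restrict_iff' hΩ.measurableSet).2 (Filter.Eventually.of_forall fun x hx => ?_)
      have h1 := (hv.continuousOn_max_pow_mul_deriv k 3).comp (f := fun s => (s, x))
        (s := Ioo (t / 2) b) (by fun_prop) fun s hs => ⟨hsub hs, hx⟩
      exact h1.continuousAt hs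

theorem integral_max_pow_le_of_ae_le (hv : IsLinearSolution Ω T m f v) (hΩ : IsOpen Ω)
    (hΩb : Bornology.IsBounded Ω) {k l D : ℝ} (hk : 0 < k) (h0 : ∀ x ∈ Ω, v 0 x ≤ k) (hD : 0 ≤ D)
    (hle : ∀ᵐ t ∂(volume.restrict (Ioi (0 : ℝ))), t ∈ timeIoo T →
      4 * ∫ x in Ω, max (v t x - k) 0 ^ 3 * deriv (fun s => v s x) t ≤
        l * (D - ∫ x in Ω, max (v t x - k) 0 ^ 4)) {b : ℝ} (hb : b ∈ timeIco T) :
    ∫ x in Ω, max (v b x - k) 0 ^ 4 ≤ D := by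
  refine le_of_hasDerivAt_le_mul_sub (l := l) hb.1 hD
    (hv.continuousOn_integral_max_pow hΩ hΩb hb k 4) ?_
    (fun t ht => (hv.hasDerivAt_integral_max_pow hΩ hΩb hb hk ht).1) fun t ht => ?_
  · refine le_of_eq (setIntegral_eq_zero_of_forall_eq_zero fun x hx => ?_)
    rw [max_eq_right (by linarith [h0 x hx])]
    norm_num
  · rw [ae_restrict_iff' measurableSet_Ioi] at hle
    -- A set of full measure is dense. A strict violation at `t` would persist nearby by continuity
    -- and so meet this set.
    have hdense := Measure.dense_of_ae hle
    obtain ⟨hd, hc⟩ := hv.hasDerivAt_integral_max_pow hΩ hΩb hb hk ht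
    by_contra hcon
    rw [not_le] at hcon
    have hev := (continuousAt_const.mul (continuousAt_const.sub hd.continuousAt)).eventually_lt hc
      hcon
    obtain ⟨s, hs, hs'⟩ := (mem_closure_iff_nhds.1 (hdense t)) _
      (hev.and (Ioo_mem_nhds ht.1 ht.2))
    exact absurd (hs' hs.2.1 (mem_timeIoo_of_le hs.2.1 hs.2.2.le hb)) (not_le.2 hs.1)

theorem exists_ae_le (hv : IsLinearSolution Ω T m f v) (hn : 3 ≤ n) (hΩ : IsOpen Ω)
    (hΩb : Bornology.IsBounded Ω) (hT : 0 < T) (hm : 0 < m) {p q F : ℝ} (hpq : p.HolderConjugate q)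
    (hpn : p < (n : ℝ) / ((n : ℝ) - 2)) (hF : 0 ≤ F)
    (hf : ∀ᵐ t ∂(volume.restrict (Ioi (0 : ℝ))), AEStronglyMeasurable (f t) (volume.restrict Ω) ∧
      eLpNorm (f t) (ENNReal.ofReal q) (volume.restrict Ω) ≤ ENNReal.ofReal F) :
    ∃ K, ∀ t ∈ timeIco T, ∀ᵐ x ∂(volume.restrict Ω), v t x ≤ K := by
  have : IsFiniteMeasure (volume.restrict Ω) := ⟨by simpa using hΩb.measure_lt_top⟩
  obtain ⟨C, hC, hdiff⟩ := exists_integral_excess_cube_mul_le hn hΩ hΩb hpq hpn hF hm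
  have h0T : (0 : ℝ) ∈ timeIco T := ⟨le_rfl, by simpa using hT⟩
  obtain ⟨B, hB⟩ := hv.exists_bound hΩb h0T
  have hδ : 0 < 4 * (1 / p - ((n : ℝ) - 2) / n) := by
    have hn' : (3 : ℝ) ≤ n := by exact_mod_cast hn
    have h2 : (0 : ℝ) < n - 2 := by linarith
    have h3 : ((n : ℝ) - 2) / n < 1 / p := by
      rw [lt_div_iff₀ h2] at hpn
      rw [div_lt_div_iff₀ (by linarith) hpq.pos]
      linarith
    linarith
  have hexc : ∀ (j : ℕ) (k : ℝ) (t : ℝ) (h : EuclideanSpace ℝ (Fin n) → ℝ),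
      ∫ x, excess Ω k (v t) x ^ (j + 1) * h x = ∫ x in Ω, max (v t x - k) 0 ^ (j + 1) * h x := by
    intro j k t h
    rw [← setIntegral_eq_integral_of_forall_compl_eq_zero (s := Ω)
      (fun x hx => by simp [excess_of_notMem hx])]
    exact setIntegral_congr_fun hΩ.measurableSet fun x hx => by simp only [excess_of_mem hx]
  -- The property iterated is uniform in time. The starting level exceeds the initial data, so the
  -- excess vanishes at `t = 0`, and it is positive, as compact support requires.
  obtain ⟨K, hK⟩ := exists_forall_pos_of_superlinear_decay
    (P := fun k μ => ∀ t ∈ timeIco T, volume {x | x ∈ Ω ∧ k < v t x} ≤ ENNReal.ofReal μ)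
    (fun k h μ hkh hP t ht =>
      (measure_mono fun x (hx : x ∈ Ω ∧ h < v t x) =>
        (⟨hx.1, hkh.trans_lt hx.2⟩ : x ∈ Ω ∧ k < v t x)).trans (hP t ht))
    (k₀ := max B 1) (μ₀ := (volume Ω).toReal + 1) (by positivity) hC hδ
    (fun t _ => (measure_mono fun x (hx : x ∈ Ω ∧ _) => hx.1).trans
      ((ENNReal.le_ofReal_iff_toReal_le hΩb.measure_lt_top.ne (by positivity)).2 (by linarith)))
    (fun k μ ν hμν hP t ht => (hP t ht).trans (ENNReal.ofReal_le_ofReal hμν))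
    (fun k h μ hk hkh hμ hP t ht => by
      have hk0 : 0 < k := one_pos.trans_le ((le_max_right _ _).trans hk)
      obtain ⟨l, hl⟩ := hdiff μ hμ
      have hle := hv.integral_max_pow_le_of_ae_le hΩ hΩb (l := l)
        (D := C * μ ^ (1 + 4 * (1 / p - ((n : ℝ) - 2) / n))) hk0
        (fun x hx => (le_abs_self _).trans ((hB 0 ⟨le_rfl, le_rfl⟩ x hx).trans
          ((le_max_left _ _).trans hk))) (by positivity) (by
          filter_upwards [hf] with s hs hsT
          obtain ⟨A, hA, hq, heq⟩ := hv.exists_coefficient s hsT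
          have := hl k (v s) A (f s) (fun x => deriv (fun r => v r x) s) hk0
            (hv.continuousOn_space (timeIoo_subset T hsT)) (hv.boundary s hsT)
            (hv.differentiableAt_space s hsT) (hv.continuousOn_gradient s hsT) hA hq
            (hv.continuousOn_deriv_time.comp (f := fun x => (s, x)) (by fun_prop)
              fun x hx => ⟨hsT, hx⟩) heq hs.1 hs.2 (hP s (timeIoo_subset T hsT))
          have h4 := hexc 3 k s (fun _ => 1)
          simp only [mul_one, Nat.reduceAdd] at h4
          rw [h4, hexc 2] at this
          exact this) ht
      -- Chebyshev: on `{v > h}` the excess over `k` is at least `h - k`.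
      have hcheb := mul_meas_ge_le_integral_of_nonneg
        (Filter.Eventually.of_forall fun x => pow_nonneg (le_max_right (v t x - k) 0) 4)
        (hv.integrable_max_pow hΩ hΩb ht k 4) ((h - k) ^ 4)
      have hhk : 0 < (h - k) ^ 4 := pow_pos (by linarith) 4
      have h1 := hcheb.trans hle
      rw [mul_comm, ← le_div_iff₀ hhk] at h1
      have h2 := (ENNReal.le_ofReal_iff_toReal_le (measure_ne_top _ _) (by positivity)).2 h1
      refine le_trans ?_ h2
      refine le_trans ?_ (Measure.le_restrict_apply _ _)
      refine measure_mono fun x hx => ⟨?_, hx.1⟩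
      have h5 : h - k ≤ max (v t x - k) 0 := le_max_of_le_left (by linarith [hx.2])
      exact pow_le_pow_left₀ (by linarith) h5 4)
  refine ⟨K, fun t ht => (ae_restrict_iff' hΩ.measurableSet).2 ?_⟩
  have hzero : volume {x | x ∈ Ω ∧ K < v t x} = 0 := by
    by_contra h
    have h1 : volume {x | x ∈ Ω ∧ K < v t x} ≠ ∞ :=
      ((measure_mono fun x hx => hx.1).trans_lt hΩb.measure_lt_top).ne
    have h2 := ENNReal.toReal_pos h h1
    have h3 := ENNReal.toReal_mono ENNReal.ofReal_ne_top (hK _ (half_pos h2) t ht)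
    rw [ENNReal.toReal_ofReal (by positivity)] at h3
    linarith
  rw [ae_iff]
  convert hzero using 3 with x
  simp

end IsLinearSolution

/-! ### Freezing the nonlocal coefficient, sign change, and the bound on the source. -/

theorem IsClassicalSolution.isLinearSolution {a : ℝ → ℝ} {g : EuclideanSpace ℝ (Fin n) → ℝ}
    {r : ℝ} {u₀ : EuclideanSpace ℝ (Fin n) → ℝ} (h : IsClassicalSolution Ω T a g r f u₀ v)
    (ha : ∀ ξ, m ≤ a ξ) : IsLinearSolution Ω T m f v where
  continuousOn := h.continuousOn
  differentiableAt_time := h.differentiableAt_time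
  continuousOn_deriv_time := h.continuousOn_deriv_time
  differentiableAt_space := h.differentiableAt_space
  continuousOn_gradient t ht := h.continuousOn_gradient.comp (f := fun x => (t, x))
    (by fun_prop) fun _ hx => ⟨ht, hx⟩
  exists_coefficient t ht := ⟨fun x => a (nonlocal Ω g r (v t) x), fun _ _ => ha _,
    h.differentiableAt_flux t ht, h.equation t ht⟩
  boundary := h.boundary

theorem gradient_fun_neg (w : EuclideanSpace ℝ (Fin n) → ℝ) (x : EuclideanSpace ℝ (Fin n)) :
    gradient (fun y => -w y) x = -gradient w x := by
  simp [gradient, fderiv_fun_neg]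

/-- Used for the lower bound: freezing the coefficient makes the problem odd in `v`, as the same `A`
serves for `-v`. -/
theorem IsLinearSolution.neg (h : IsLinearSolution Ω T m f v) :
    IsLinearSolution Ω T m (fun t x => -f t x) fun t x => -v t x where
  continuousOn := h.continuousOn.neg
  differentiableAt_time t ht x hx := (h.differentiableAt_time t ht x hx).neg
  continuousOn_deriv_time := h.continuousOn_deriv_time.neg.congr fun z _ => deriv.fun_neg
  differentiableAt_space t ht x hx := (h.differentiableAt_space t ht x hx).neg
  continuousOn_gradient t ht := (h.continuousOn_gradient t ht).neg.congr
    fun x _ => gradient_fun_neg _ _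
  exists_coefficient t ht := by
    obtain ⟨A, hA, hq, heq⟩ := h.exists_coefficient t ht
    have hneg : (fun x => A x • gradient (fun y => -v t y) x) =
        fun x => -(A x • gradient (v t) x) := by
      ext1 x; rw [gradient_fun_neg, smul_neg]
    refine ⟨A, hA, ?_, ?_⟩
    · rw [hneg]
      exact fun x hx => (hq x hx).neg
    · intro x hx
      rw [hneg, ← heq x hx, deriv.fun_neg, divergence, divergence, fderiv_fun_neg]
      simp
      ring
  boundary t ht x hx := by simp [h.boundary t ht x hx]

theorem MemLinftyLq.exists_ae_eLpNorm_le {q : ℝ} {hq : 1 < q} (hf : MemLinftyLq Ω q hq f) :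
    ∃ F ≥ 0, ∀ᵐ t ∂(volume.restrict (Ioi (0 : ℝ))),
      AEStronglyMeasurable (f t) (volume.restrict Ω) ∧
        eLpNorm (f t) (ENNReal.ofReal q) (volume.restrict Ω) ≤ ENNReal.ofReal F := by
  have : Fact (1 ≤ ENNReal.ofReal q) := ⟨ENNReal.one_le_ofReal.2 hq.le⟩
  obtain ⟨G, hG, hGf⟩ := hf
  refine ⟨(eLpNormEssSup G (volume.restrict (Ioi (0 : ℝ)))).toReal, ENNReal.toReal_nonneg, ?_⟩
  have hfin : eLpNormEssSup G (volume.restrict (Ioi (0 : ℝ))) ≠ ∞ := by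
    simpa using hG.2.ne
  filter_upwards [hGf, ae_le_eLpNormEssSup (f := G) (μ := volume.restrict (Ioi (0 : ℝ)))]
    with t ht hle
  refine ⟨(Lp.aestronglyMeasurable (G t)).congr ht, ?_⟩
  rw [ENNReal.ofReal_toReal hfin, ← eLpNorm_congr_ae ht, ← Lp.enorm_def]
  exact hle

end LinearSolution

end NonlocalDiffusion

theorem theorem4p1 {n : ℕ} (hn : 3 ≤ n)
    (Ω : Set (EuclideanSpace ℝ (Fin n))) (hΩ : IsOpen Ω) (hΩb : Bornology.IsBounded Ω)
    (a : ℝ → ℝ) (ha : Continuous a) (m M : ℝ) (hm : 0 < m)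
    (haM : ∀ ξ : ℝ, m ≤ a ξ ∧ a ξ ≤ M)
    (g : EuclideanSpace ℝ (Fin n) → ℝ) (hg : MemLp g 2 (volume.restrict Ω))
    (r : ℝ) (hr : 0 ≤ r)
    (p q : ℝ) (hp : 1 < p) (hq : 1 < q) (hpq : 1 / p + 1 / q = 1)
    (hpn : p < (n : ℝ) / ((n : ℝ) - 2))
    (T : EReal) (hT : 0 < T)
    (f : ℝ → EuclideanSpace ℝ (Fin n) → ℝ) (hf : NonlocalDiffusion.MemLinftyLq Ω q hq f)
    (u₀ : EuclideanSpace ℝ (Fin n) → ℝ)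
    (u : ℝ → EuclideanSpace ℝ (Fin n) → ℝ)
    (hu : NonlocalDiffusion.IsClassicalSolution Ω T a g r f u₀ u)
    (hUq : NonlocalDiffusion.supLpNorm Ω T (ENNReal.ofReal q) u < ∞) :
    NonlocalDiffusion.supLpNorm Ω T ∞ u < ∞ := by
  have hconj : p.HolderConjugate q :=
    Real.holderConjugate_iff.2 ⟨hp, by simpa only [one_div] using hpq⟩
  obtain ⟨F, hF, hfF⟩ := hf.exists_ae_eLpNorm_le
  have hlin := hu.isLinearSolution fun ξ => (haM ξ).1
  obtain ⟨K₁, hK₁⟩ := hlin.exists_ae_le hn hΩ hΩb hT hm hconj hpn hF hfF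
  obtain ⟨K₂, hK₂⟩ := hlin.neg.exists_ae_le hn hΩ hΩb hT hm hconj hpn hF (by
    filter_upwards [hfF] with t ht
    exact ⟨ht.1.neg, (eLpNorm_neg (f t) _ _).trans_le ht.2⟩)
  refine lt_of_le_of_lt (iSup₂_le fun t ht => ?_)
    (ENNReal.ofReal_lt_top (r := max K₁ K₂))
  rw [eLpNorm_exponent_top]
  refine eLpNormEssSup_le_of_ae_bound ?_
  filter_upwards [hK₁ t ht, hK₂ t ht] with x h1 h2
  rw [Real.norm_eq_abs]
  exact abs_le.2 ⟨by linarith [le_max_right K₁ K₂], h1.trans (le_max_left _ _)⟩
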